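/- Let $N$ and $m$ be positive integers with $N$ odd, and suppose that either $m$ is odd, or $m$ is even and $N>1$. Then the series $$A=\sum_{n=1}^{\infty}\frac{n^{-2Nm-1}}{\exp\left((2n)^N\pi\right)-1},\qquad B_j=\sum_{n=1}^{\infty}\frac{1}{n^{2m+1}}\,\mathrm{Re}\left(\frac{1}{\exp\left((2n)^{1/N}\pi e^{i\pi j/N}\right)-1}\right)\quad\left(j\in\mathbb{Z},\ 0\le j\le\frac{N-1}{2}\right)$$ converge absolutely, where $(2n)^{1/N}$ denotes the positive real root, and at least one of the numbers $$\zeta(2m+1),\quad \zeta(2Nm+1),\quad A,\quad B_0,\ B_1,\ \dots,\ B_{(N-1)/2}$$ is transcendental over $\mathbb{Q}$, where $\zeta$ is the Riemann zeta function. -/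

import Mathlib

/-- The `n`-th term `n ^ (-2Nm-1) / (exp ((2n) ^ N π) - 1)`, `n ≥ 1`. -/
noncomputable def lambertTerm (N m : ℕ) (n : ℕ+) : ℝ :=
  (n : ℝ) ^ (-2 * (N : ℤ) * (m : ℤ) - 1) / (Real.exp ((2 * (n : ℝ)) ^ N * Real.pi) - 1)

/-- The `n`-th term `(1 / n ^ (2m+1)) Re (1 / (exp ((2n) ^ (1/N) π e ^ (iπj/N)) - 1))`, `n ≥ 1`;
`(2n) ^ (1/N)` is the positive real `N`-th root. -/
noncomputable def lambertRootTerm (N m j : ℕ) (n : ℕ+) : ℝ :=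
  1 / (n : ℝ) ^ (2 * m + 1) *
    (1 / (Complex.exp ((((2 * (n : ℝ)) ^ (1 / (N : ℝ)) : ℝ) : ℂ) * (Real.pi : ℂ) *
      Complex.exp (Complex.I * (Real.pi : ℂ) * (j : ℂ) / (N : ℂ))) - 1)).re

/-! The quantities are tied together by the double sums `latticeSum N m i` over n, k ≥ 1, whose
terms have denominator (2n)^(2N) + (2k)^2. For i = 0, summing over k first gives the partial
fractions of 1/(e^x - 1) at x = (2n)^N π, hence A and ζ(2Nm+1) (`hasSum_lambertTerm`). For i = m,
summing over n first gives the same kernel averaged over the N-th roots of unity, hence the B_j and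
ζ(2m+1) (`hasSum_sum_kernelTerm`, `exists_hasSum_kernelTerm`). Consecutive indices are linked by a
product of two even zeta values, a rational multiple of a power of π (`four_mul_latticeSum_add`).

So a rational combination of the listed numbers equals a rational polynomial in π
(`exists_relation`). If N > 1, its top term π^(2Nm+N) cannot cancel. If N = 1, every term is a
multiple of π^(2m+1); for odd m the combination is a sum of nonnegative terms with one positive,
hence nonzero. Transcendence of π finishes both cases; it follows from Lindemann's argument in
`cexp_ne_neg_one_of_isAlgebraic`. -/

/-! ### Transcendence of π -/

open Polynomial in
/-- A polynomial expression of degree at most `M` in a root of `f`, scaled by the `M`-th power of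
the leading coefficient of `f`, is an algebraic integer. -/
theorem isIntegral_leadingCoeff_pow_mul_aeval {K : Type*} [CommRing K] {f g : ℤ[X]} {x : K}
    (hx : aeval x f = 0) {M : ℕ} (hg : g.natDegree ≤ M) :
    IsIntegral ℤ ((f.leadingCoeff : K) ^ M * aeval x g) := by
  have h1 : IsIntegral ℤ ((f.leadingCoeff : K) * x) := by
    simpa using isIntegral_leadingCoeff_smul f x hx
  rw [aeval_eq_sum_range' (Nat.lt_succ_of_le hg), Finset.mul_sum]
  refine IsIntegral.sum _ fun i hi => ?_
  have hi' : i ≤ M := Nat.lt_succ_iff.mp (Finset.mem_range.mp hi)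
  have : (f.leadingCoeff : K) ^ M * g.coeff i • x ^ i =
      (g.coeff i : K) * (f.leadingCoeff : K) ^ (M - i) * ((f.leadingCoeff : K) * x) ^ i := by
    rw [zsmul_eq_mul, mul_pow]
    conv_lhs => rw [← Nat.sub_add_cancel hi', pow_add]
    ring
  rw [this]
  have hz : ∀ z : ℤ, IsIntegral ℤ (z : K) := fun z => by
    simpa using (isIntegral_algebraMap (R := ℤ) (A := K) (x := z))
  exact ((hz _).mul ((hz _).pow _)).mul (h1.pow _)

/-- A Galois-equivariant function summed over all subset sums of a Galois-stable finite set
is rational. -/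
theorem sum_powerset_mem_bot {k K : Type*} [Field k] [Field K] [Algebra k K] [IsGalois k K]
    (T : Finset K) (hT : ∀ σ : K ≃ₐ[k] K, ∀ a ∈ T, σ a ∈ T) (φ : K → K)
    (hφ : ∀ (σ : K ≃ₐ[k] K) (x : K), σ (φ x) = φ (σ x)) :
    (∑ S ∈ T.powerset, φ (∑ a ∈ S, a)) ∈ (⊥ : IntermediateField k K) := by
  classical
  rw [InfiniteGalois.mem_bot_iff_fixed]
  intro σ
  rw [map_sum]
  have key : ∀ τ : K ≃ₐ[k] K, ∀ S ∈ T.powerset,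
      S.map τ.toEquiv.toEmbedding ∈ T.powerset := by
    intro τ S hS
    rw [Finset.mem_powerset] at hS ⊢
    intro b hb
    obtain ⟨a, ha, rfl⟩ := Finset.mem_map.mp hb
    exact hT τ a (hS ha)
  refine Finset.sum_bij' (fun S _ => S.map σ.toEquiv.toEmbedding)
    (fun S _ => S.map σ.symm.toEquiv.toEmbedding) (key σ) (key σ.symm) ?_ ?_ ?_
  · intro S _
    ext x; simp
  · intro S _
    ext x; simp
  · intro S _
    rw [hφ, map_sum, Finset.sum_map]
    rfl

/-- Subset sums of the conjugates of a number in which `exp` takes the value `-1`: the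
exponentials add up to zero. -/
theorem sum_powerset_cexp_eq_zero {K : Type*} [Field K] [Algebra K ℂ] (T : Finset K) {a : K}
    (ha : a ∈ T) (h : Complex.exp (algebraMap K ℂ a) = -1) :
    ∑ S ∈ T.powerset, Complex.exp (algebraMap K ℂ (∑ b ∈ S, b)) = 0 := by
  have h1 := Finset.prod_one_add (f := fun b : K => Complex.exp (algebraMap K ℂ b)) T
  rw [Finset.prod_eq_zero ha (by rw [h]; ring)] at h1
  rw [h1]
  exact Finset.sum_congr rfl fun S _ => by rw [map_sum, Complex.exp_sum]

open Polynomial in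
/-- Finitely many nonzero algebraic numbers are roots of an integer polynomial that does not
vanish at zero. -/
theorem exists_int_polynomial_eval_zero_ne_zero {ι K : Type*} [Field K] [CharZero K]
    [Algebra ℚ K] (s : Finset ι) (x : ι → K) (hx : ∀ i ∈ s, x i ≠ 0)
    (halg : ∀ i ∈ s, IsAlgebraic ℚ (x i)) :
    ∃ f : ℤ[X], f.eval 0 ≠ 0 ∧ ∀ i ∈ s, aeval (x i) f = 0 := by
  have h : ∀ i : ι, ∃ q : ℤ[X], q.coeff 0 ≠ 0 ∧ (i ∈ s → aeval (x i) q = 0) := by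
    intro i
    by_cases hi : i ∈ s
    · obtain ⟨q, h1, h2⟩ := IsAlgebraic.exists_nonzero_coeff_and_aeval_eq_zero
        ((IsFractionRing.isAlgebraic_iff ℤ ℚ K).mpr (halg i hi))
        (mem_nonZeroDivisors_of_ne_zero (hx i hi))
      exact ⟨q, h1, fun _ => h2⟩
    · exact ⟨1, by simp, fun h => absurd h hi⟩
  choose q h1 h2 using h
  refine ⟨∏ i ∈ s, q i, ?_, fun i hi => ?_⟩
  · rw [eval_prod, Finset.prod_ne_zero_iff]
    intro i _
    rw [← coeff_zero_eq_eval_zero]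
    exact h1 i
  · rw [map_prod]
    exact Finset.prod_eq_zero hi (h2 i hi)

-- Makes the analytic error in Lindemann's argument eventually smaller than 1, despite the scaling
-- by powers of the leading coefficient.
open Filter Topology in
theorem tendsto_mul_pow_div_factorial_pred (r c : ℝ) :
    Tendsto (fun p : ℕ => r * c ^ p / (p - 1).factorial) atTop (𝓝 0) := by
  have h := (FloorSemiring.tendsto_pow_div_factorial_atTop c).const_mul (r * c)
  rw [mul_zero] at h
  rw [← tendsto_add_atTop_iff_nat 1]
  refine h.congr fun n => ?_
  rw [Nat.add_sub_cancel, pow_succ]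
  ring

open Polynomial in
/-- An algebraic number is not a logarithm of `-1`. -/
theorem cexp_ne_neg_one_of_isAlgebraic {z : ℂ} (hz : IsAlgebraic ℚ z) : Complex.exp z ≠ -1 := by
  classical
  intro hexp
  have : IsAlgClosure ℚ (algebraicClosure ℚ ℂ) := algebraicClosure.isAlgClosure ℚ ℂ
  have : Normal ℚ (algebraicClosure ℚ ℂ) := IsAlgClosure.normal ℚ _
  have : IsGalois ℚ (algebraicClosure ℚ ℂ) := ⟨⟩
  let K := algebraicClosure ℚ ℂ
  let a : K := ⟨z, mem_algebraicClosure_iff.mpr hz⟩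
  have hK : ∀ x : K, IsAlgebraic ℚ x := fun x => Algebra.IsAlgebraic.isAlgebraic x
  have haint : IsIntegral ℚ a := (hK a).isIntegral
  let T : Finset K := ((minpoly ℚ a).aroots K).toFinset
  have memT : ∀ b : K, b ∈ T ↔ aeval b (minpoly ℚ a) = 0 := fun b => by
    simp [T, minpoly.ne_zero haint]
  have hT : ∀ σ : K ≃ₐ[ℚ] K, ∀ b ∈ T, σ b ∈ T := by
    intro σ b hb
    rw [memT] at hb ⊢
    rw [aeval_algHom_apply σ, hb, map_zero]
  have hsum := sum_powerset_cexp_eq_zero T ((memT a).mpr (minpoly.aeval ℚ a)) hexp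
  -- The approximation needs a polynomial nonvanishing at 0, so vanishing subset sums are set aside.
  -- They contribute the integer `k`, positive because of the empty set.
  let s : Finset (Finset K) := T.powerset.filter fun S => ∑ b ∈ S, b ≠ 0
  let k : ℕ := (T.powerset.filter fun S => ¬ ∑ b ∈ S, b ≠ 0).card
  have hk : 0 < k := Finset.card_pos.mpr ⟨∅, by simp⟩
  have hsum' : ∑ S ∈ s, Complex.exp (algebraMap K ℂ (∑ b ∈ S, b)) + k = 0 := by
    rw [← hsum, ← Finset.sum_filter_add_sum_filter_not T.powerset (fun S => ∑ b ∈ S, b ≠ 0)]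
    congr 1
    rw [Finset.sum_congr rfl (g := fun _ => (1 : ℂ))]
    · simp [k]
    · intro S hS
      have : ∑ b ∈ S, b = 0 := not_not.mp (Finset.mem_filter.mp hS).2
      rw [this, map_zero, Complex.exp_zero]
  obtain ⟨f, hf0, hf⟩ := exists_int_polynomial_eval_zero_ne_zero s (fun S => ∑ b ∈ S, b)
    (fun S hS => (Finset.mem_filter.mp hS).2) (fun S _ => hK _)
  obtain ⟨c, hc⟩ := LindemannWeierstrass.exp_polynomial_approx f hf0
  have hfne : f ≠ 0 := fun h => hf0 (by simp [h])
  set l : ℤ := f.leadingCoeff with hl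
  have hl0 : l ≠ 0 := leadingCoeff_ne_zero.mpr hfne
  set D := f.natDegree
  have hev := (tendsto_mul_pow_div_factorial_pred s.card (|(l : ℝ)| ^ D * c)).eventually
    (gt_mem_nhds one_pos)
  obtain ⟨p₀, hp₀⟩ := Filter.eventually_atTop.mp hev
  -- Large enough for the error to be below 1 and for `p` to divide neither `l` nor `k`.
  obtain ⟨p, hpge, hp⟩ := Nat.exists_infinite_primes
    (p₀ + (eval 0 f).natAbs + l.natAbs + k + 1)
  obtain ⟨n, hpn, g, hg, happ⟩ := hc p (by omega) hp
  -- the algebraic part is an integer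
  obtain ⟨G, hG⟩ : ∃ G : ℤ, (l : ℂ) ^ (p * D) *
      ∑ S ∈ s, aeval (algebraMap K ℂ (∑ b ∈ S, b)) g = G := by
    -- The restriction to nonzero sums is moved inside the function, so that the sum runs over the
    -- whole Galois-stable powerset. Being rational and integral, it is an integer.
    have hbot := sum_powerset_mem_bot (k := ℚ) T hT
      (fun x => if x ≠ 0 then (l : K) ^ (p * D) * aeval x g else 0) (by
        intro σ x
        by_cases hx : x = 0
        · simp [hx]
        · simp only [ne_eq, hx, not_false_eq_true, if_true, EmbeddingLike.map_eq_zero_iff, map_mul,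
            map_pow, map_intCast]
          congr 1
          have := aeval_algHom_apply (σ.toAlgHom.restrictScalars ℤ) x g
          simpa using this.symm)
    rw [← Finset.sum_filter, IntermediateField.mem_bot] at hbot
    obtain ⟨q, hq⟩ := hbot
    have hint : IsIntegral ℤ (algebraMap ℚ K q) := by
      rw [hq]
      refine IsIntegral.sum _ fun S hS => ?_
      exact isIntegral_leadingCoeff_pow_mul_aeval (hf S hS) (hg.trans (Nat.sub_le _ _))
    rw [isIntegral_algebraMap_iff (algebraMap ℚ K).injective,
      IsIntegrallyClosed.isIntegral_iff] at hint
    obtain ⟨G, rfl⟩ := hint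
    refine ⟨G, ?_⟩
    have := congrArg (algebraMap K ℂ) hq
    rw [map_sum] at this
    simp only [map_mul, map_pow, map_intCast, eq_intCast] at this
    rw [this, Finset.mul_sum]
    refine Finset.sum_congr rfl fun S _ => ?_
    rw [aeval_algebraMap_apply]
  have hZ : (((l ^ (p * D) * (n * k) + p * G : ℤ)) : ℂ) = -((l : ℂ) ^ (p * D) *
      ∑ S ∈ s, (n • Complex.exp (algebraMap K ℂ (∑ b ∈ S, b)) -
        p • aeval (algebraMap K ℂ (∑ b ∈ S, b)) g)) := by
    simp only [Int.cast_add, Int.cast_mul, Int.cast_pow, Int.cast_natCast]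
    rw [← hG, Finset.sum_sub_distrib, ← Finset.smul_sum, ← Finset.smul_sum,
      eq_neg_of_add_eq_zero_left hsum', zsmul_eq_mul, nsmul_eq_mul]
    ring
  have hle : ‖(((l ^ (p * D) * (n * k) + p * G : ℤ)) : ℂ)‖ < 1 := by
    rw [hZ, norm_neg, norm_mul, norm_pow]
    refine lt_of_le_of_lt ?_ (hp₀ p (by omega))
    have h1 : ‖∑ S ∈ s, (n • Complex.exp (algebraMap K ℂ (∑ b ∈ S, b)) -
        p • aeval (algebraMap K ℂ (∑ b ∈ S, b)) g)‖ ≤ s.card * (c ^ p / (p - 1).factorial) := by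
      rw [← nsmul_eq_mul]
      refine (norm_sum_le _ _).trans (Finset.sum_le_card_nsmul _ _ _ fun S hS => ?_)
      refine happ ?_
      rw [mem_aroots]
      exact ⟨hfne, by rw [aeval_algebraMap_apply, hf S hS, map_zero]⟩
    calc ‖(l : ℂ)‖ ^ (p * D) * _ ≤ ‖(l : ℂ)‖ ^ (p * D) *
          (s.card * (c ^ p / (p - 1).factorial)) := by gcongr
      _ = _ := by
        rw [Complex.norm_intCast, mul_pow, ← pow_mul, mul_comm p D]
        ring
  rw [Complex.norm_intCast, ← Int.cast_abs] at hle
  have hzero : l ^ (p * D) * (n * k) + p * G = 0 := by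
    rw [← Int.abs_lt_one_iff]
    exact_mod_cast hle
  have hdvd : (p : ℤ) ∣ l ^ (p * D) * (n * k) :=
    ⟨-G, by linear_combination hzero⟩
  have hp' : Prime (p : ℤ) := Nat.prime_iff_prime_int.mp hp
  rcases hp'.dvd_or_dvd hdvd with h | h
  · have := Int.natAbs_dvd_natAbs.mpr (hp'.dvd_of_dvd_pow h)
    have := Nat.le_of_dvd (Int.natAbs_pos.mpr hl0) this
    simp only [Int.natAbs_natCast] at this
    omega
  · rcases hp'.dvd_or_dvd h with h | h
    · exact hpn h
    · have := Nat.le_of_dvd hk (Int.natCast_dvd_natCast.mp h)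
      omega

theorem transcendental_pi : Transcendental ℚ Real.pi := by
  intro h
  have h1 : IsAlgebraic ℚ (Real.pi : ℂ) := h.algebraMap (A := ℂ)
  have hI : IsAlgebraic ℚ Complex.I :=
    ⟨Polynomial.X ^ 2 + 1, Polynomial.Monic.ne_zero (by monicity!), by simp⟩
  exact cexp_ne_neg_one_of_isAlgebraic (h1.mul hI) Complex.exp_pi_mul_I

/-! ### The kernel, its partial fractions and averages over roots of unity -/

/-- The odd function `1 / (e ^ x - 1) + 1 / 2`, that is, `coth (x / 2) / 2`. -/
noncomputable def expKernel (x : ℂ) : ℂ := 1 / (Complex.exp x - 1) + 1 / 2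

theorem expKernel_neg {x : ℂ} (hx : Complex.exp x ≠ 1) : expKernel (-x) = -expKernel x := by
  have h1 := Complex.exp_ne_zero x
  have h2 : Complex.exp x - 1 ≠ 0 := sub_ne_zero.mpr hx
  have h3 : 1 - Complex.exp x ≠ 0 := sub_ne_zero.mpr hx.symm
  have h4 : (Complex.exp x)⁻¹ - 1 ≠ 0 := by
    intro h
    apply hx
    rw [sub_eq_zero, inv_eq_one] at h
    exact h
  rw [expKernel, expKernel, Complex.exp_neg]
  have h5 : 1 / ((Complex.exp x)⁻¹ - 1) = Complex.exp x / (1 - Complex.exp x) := by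
    field_simp
  rw [h5, ← neg_sub, div_neg]
  field_simp
  ring

open ComplexConjugate in
theorem expKernel_conj (x : ℂ) : expKernel (conj x) = conj (expKernel x) := by
  simp [expKernel, ← Complex.exp_conj, map_ofNat]

/-- Partial fraction expansion of `expKernel`. -/
theorem hasSum_expKernel {x : ℂ} (hx : ∀ l : ℤ, x ^ 2 + (2 * Real.pi * l) ^ 2 ≠ 0) :
    HasSum (fun n : ℕ+ => 2 * (x / (x ^ 2 + (2 * Real.pi * (n : ℝ) : ℝ) ^ 2)))
      (expKernel x - 1 / x) := by
  have hpi : (Real.pi : ℂ) ≠ 0 := Complex.ofReal_ne_zero.mpr Real.pi_ne_zero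
  have hI := Complex.I_ne_zero
  have hx0 : x ≠ 0 := by
    rintro rfl
    simpa using hx 0
  -- The expansion is that of π cot(πz) at z = x / (2πi).
  have hz : x / (2 * Real.pi * Complex.I) ∈ Complex.integerComplement := by
    rintro ⟨l, hl⟩
    apply hx l
    have : x = 2 * Real.pi * Complex.I * l := by
      rw [hl]; field_simp
    rw [this]
    linear_combination (2 * (Real.pi : ℂ) * l) ^ 2 * Complex.I_sq
  have h1 := (summable_cotTerm hz).hasSum
  have h2 := cot_series_rep' hz
  unfold cotTerm at h1
  rw [← h2, Complex.cot_pi_eq_exp_ratio, ← Equiv.pnatEquivNat.hasSum_iff] at h1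
  have hexp : 2 * Real.pi * Complex.I * (x / (2 * Real.pi * Complex.I)) = x := by
    field_simp
  rw [hexp] at h1
  have hne : Complex.exp x - 1 ≠ 0 := by
    intro h
    rw [sub_eq_zero, Complex.exp_eq_one_iff] at h
    obtain ⟨l, hl⟩ := h
    apply hx l
    rw [hl]
    linear_combination (2 * (Real.pi : ℂ) * l) ^ 2 * Complex.I_sq
  have hne' : 1 - Complex.exp x ≠ 0 := by
    intro h; apply hne; linear_combination -h
  have h3 := h1.mul_left (1 / (2 * Real.pi * Complex.I))
  convert! h3 using 1
  · funext n
    have hn : ((Equiv.pnatEquivNat n : ℕ) : ℂ) + 1 = (n : ℕ) := by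
      have : n.natPred + 1 = (n : ℕ) := n.natPred_add_one
      exact_mod_cast this
    have hxn := hx n
    simp only [Function.comp, hn]
    push_cast at hxn ⊢
    set w : ℂ := ((n : ℕ) : ℂ)
    have hfac : x ^ 2 + (2 * Real.pi * w) ^ 2 =
        (x - w * (2 * Real.pi * Complex.I)) * (x + w * (2 * Real.pi * Complex.I)) := by
      linear_combination (2 * (Real.pi : ℂ) * w) ^ 2 * Complex.I_sq
    rw [hfac] at hxn ⊢
    have ha := left_ne_zero_of_mul hxn
    have hb := right_ne_zero_of_mul hxn
    have e1 : x / (2 * Real.pi * Complex.I) - w =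
      (x - w * (2 * Real.pi * Complex.I)) / (2 * Real.pi * Complex.I) := by field_simp
    have e2 : x / (2 * Real.pi * Complex.I) + w =
      (x + w * (2 * Real.pi * Complex.I)) / (2 * Real.pi * Complex.I) := by field_simp
    rw [e1, e2, one_div_div, one_div_div]
    rw [div_add_div _ _ ha hb, mul_div, mul_div_assoc', div_left_inj' hxn]
    field_simp
    ring
  · rw [expKernel, one_div_div]
    field_simp
    linear_combination (-(x * (Complex.exp x - 1)* (Complex.exp x + 1))) * Complex.I_sq

/-- Sums of odd powers of a root of unity of odd order. -/
theorem sum_pow_odd_of_isPrimitiveRoot {N h : ℕ} (hN : N = 2 * h + 1) {η : ℂ}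
    (hη : IsPrimitiveRoot η N) {l : ℕ} (hl : l < N) :
    ∑ j ∈ Finset.range N, (η ^ j) ^ (2 * l + 1) = if l = h then (N : ℂ) else 0 := by
  simp_rw [← pow_mul, mul_comm _ (2 * l + 1), pow_mul]
  split_ifs with hlh
  · subst hlh
    rw [← hN, hη.pow_eq_one]
    simp
  · have hne : η ^ (2 * l + 1) ≠ 1 := by
      intro h1
      obtain ⟨d, hd⟩ := hη.dvd_of_pow_eq_one _ h1
      have hd2 : d < 2 := by
        by_contra hd2
        have := Nat.mul_le_mul_left N (not_lt.mp hd2)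
        omega
      interval_cases d <;> omega
    have h2 := geom_sum_mul (η ^ (2 * l + 1)) N
    rw [← pow_mul, mul_comm _ N, pow_mul, hη.pow_eq_one, one_pow, sub_self] at h2
    exact (mul_eq_zero.mp h2).resolve_right (sub_ne_zero.mpr hne)

/-- A partial fraction decomposition over the roots of unity of odd order `N`. -/
theorem sum_div_sq_add_sq {N h : ℕ} (hN : N = 2 * h + 1) {η : ℂ} (hη : IsPrimitiveRoot η N)
    {y c : ℂ} (hne : ∀ j, (y * η ^ j) ^ 2 + c ^ 2 ≠ 0) (hne' : y ^ (2 * N) + c ^ (2 * N) ≠ 0) :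
    ∑ j ∈ Finset.range N, y * η ^ j / ((y * η ^ j) ^ 2 + c ^ 2) =
      N * (-1) ^ h * y ^ N * c ^ (N - 1) / (y ^ (2 * N) + c ^ (2 * N)) := by
  have h1 : ∀ j, y * η ^ j / ((y * η ^ j) ^ 2 + c ^ 2) =
      (∑ l ∈ Finset.range N, (-1) ^ l * y ^ (2 * l + 1) * (c ^ 2) ^ (N - 1 - l) *
        (η ^ j) ^ (2 * l + 1)) / (y ^ (2 * N) + c ^ (2 * N)) := by
    intro j
    rw [div_eq_div_iff (hne j) hne']
    -- Since (-(y η^j)^2)^N = -y^(2N), the geometric sum produces a denominator free of `j`; the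
    -- numerators are odd powers of η^j, of which only the N-th survives summation.
    have hg := geom_sum₂_mul (-((y * η ^ j) ^ 2)) (c ^ 2) N
    have ho : Odd N := ⟨h, hN⟩
    have hp : (-((y * η ^ j) ^ 2)) ^ N = -y ^ (2 * N) := by
      rw [ho.neg_pow, ← pow_mul, mul_pow, ← pow_mul, mul_comm j, mul_comm 2 N, mul_assoc,
        pow_mul η, hη.pow_eq_one, one_pow, mul_one]
    rw [hp, ← pow_mul] at hg
    have hs : ∑ l ∈ Finset.range N, (-1) ^ l * y ^ (2 * l + 1) * (c ^ 2) ^ (N - 1 - l) *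
        (η ^ j) ^ (2 * l + 1) = y * η ^ j *
        ∑ l ∈ Finset.range N, (-((y * η ^ j) ^ 2)) ^ l * (c ^ 2) ^ (N - 1 - l) := by
      rw [Finset.mul_sum]
      refine Finset.sum_congr rfl fun l _ => ?_
      rw [neg_pow ((y * η ^ j) ^ 2), ← pow_mul (y * η ^ j), mul_pow y, pow_succ y, pow_succ (η ^ j)]
      ring
    rw [hs]
    linear_combination (y * η ^ j) * hg
  simp_rw [h1]
  rw [← Finset.sum_div, Finset.sum_comm]
  congr 1
  have hh : h ∈ Finset.range N := Finset.mem_range.mpr (by omega)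
  rw [Finset.sum_eq_single_of_mem h hh]
  · rw [← Finset.mul_sum, sum_pow_odd_of_isPrimitiveRoot hN hη (Finset.mem_range.mp hh),
      if_pos rfl, ← hN, ← pow_mul, show 2 * (N - 1 - h) = N - 1 by omega]
    ring
  · intro l hl hlh
    rw [← Finset.mul_sum, sum_pow_odd_of_isPrimitiveRoot hN hη (Finset.mem_range.mp hl),
      if_neg hlh, mul_zero]

/-- Positive multiples of roots of unity of odd order avoid the imaginary axis. -/
theorem mul_root_sq_add_sq_ne_zero {N : ℕ} (hN : Odd N) {η : ℂ} (hη : η ^ N = 1) {y : ℝ}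
    (hy : 0 < y) (c : ℝ) (j : ℕ) : ((y : ℂ) * η ^ j) ^ 2 + (c : ℂ) ^ 2 ≠ 0 := by
  intro h
  have h1 : (((y : ℂ) * η ^ j) ^ 2) ^ N = (-(c : ℂ) ^ 2) ^ N := by
    rw [eq_neg_of_add_eq_zero_left h]
  rw [hN.neg_pow, mul_pow, mul_pow, ← pow_mul η, ← pow_mul η, mul_comm _ N,
    pow_mul η, hη, one_pow, mul_one] at h1
  have h2 : (y ^ 2) ^ N = -(c ^ 2) ^ N := by exact_mod_cast h1
  have h3 : 0 < (y ^ 2) ^ N := by positivity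
  have h4 : 0 ≤ (c ^ 2) ^ N := by positivity
  linarith

/-- The sum of `expKernel` over a positive multiple of the roots of unity of odd order. -/
theorem hasSum_sum_expKernel {N h : ℕ} (hN : N = 2 * h + 1) {η : ℂ} (hη : IsPrimitiveRoot η N)
    {y : ℝ} (hy : 0 < y) :
    HasSum (fun n : ℕ+ => 2 * (N * (-1) ^ h * y ^ N * (2 * Real.pi * (n : ℝ)) ^ (N - 1) /
        (y ^ (2 * N) + (2 * Real.pi * (n : ℝ)) ^ (2 * N))))
      (∑ j ∈ Finset.range N, (expKernel (y * η ^ j)).re - if N = 1 then 1 / y else 0) := by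
  have ho : Odd N := ⟨h, hN⟩
  have hne := mul_root_sq_add_sq_ne_zero ho hη.pow_eq_one hy
  have h1 : ∀ j ∈ Finset.range N, HasSum (fun n : ℕ+ =>
      2 * (y * η ^ j / ((y * η ^ j) ^ 2 + (2 * Real.pi * (n : ℝ) : ℝ) ^ 2)))
      (expKernel (y * η ^ j) - 1 / (y * η ^ j)) := fun j _ =>
    hasSum_expKernel fun l => by
      have := hne (2 * Real.pi * l) j
      push_cast at this
      exact this
  have h2 := hasSum_sum h1
  have h3 := Complex.hasSum_re h2
  convert! h3 using 1
  · funext n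
    rw [← Finset.mul_sum, sum_div_sq_add_sq hN hη (hne _)]
    · norm_cast
    · norm_cast
      have hn : 0 < (n : ℝ) := by exact_mod_cast n.pos
      positivity
  · rw [Finset.sum_sub_distrib, Complex.sub_re, Complex.re_sum]
    congr 1
    have h4 : ∀ j : ℕ, 1 / ((y : ℂ) * η ^ j) = 1 / y * η⁻¹ ^ j := fun j => by
      rw [inv_pow]; field_simp
    simp_rw [h4]
    rw [← Finset.mul_sum]
    -- The polar parts 1/x cancel over the roots of unity unless N = 1.
    split_ifs with hN1
    · subst hN1
      simp
    · rw [hη.inv.geom_sum_eq_zero (by omega), mul_zero, Complex.zero_re]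

/-! ### Zeta values at integers -/

/-- The sum `1 + 1 / 2 ^ a + 1 / 3 ^ a + ⋯`. -/
noncomputable def pseries (a : ℕ) : ℝ := ∑' n : ℕ+, 1 / (n : ℝ) ^ a

theorem hasSum_pseries {a : ℕ} (ha : 1 < a) :
    HasSum (fun n : ℕ+ => 1 / (n : ℝ) ^ a) (pseries a) :=
  Summable.hasSum <| (Real.summable_one_div_nat_pow.mpr ha).comp_injective PNat.coe_injective

theorem riemannZeta_eq_pseries {a : ℕ} (ha : 1 < a) : riemannZeta a = (pseries a : ℂ) := by
  have h := (hasSum_pnat_iff (f := fun n : ℕ => 1 / (n : ℝ) ^ a)).mp (hasSum_pseries ha)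
  -- The term at n = 0 is 1 / 0 = 0, so including it is harmless.
  rw [Nat.cast_zero, zero_pow (by omega), div_zero, add_zero] at h
  rw [zeta_nat_eq_tsum_of_gt_one ha, ← h.tsum_eq, Complex.ofReal_tsum]
  push_cast
  rfl

theorem pseries_pos {a : ℕ} (ha : 1 < a) : 0 < pseries a :=
  (hasSum_pseries ha).summable.tsum_pos (fun n => by positivity) 1 (by simp)

theorem exists_rat_pseries_even {a : ℕ} (ha : a ≠ 0) :
    ∃ q : ℚ, q ≠ 0 ∧ pseries (2 * a) = q * Real.pi ^ (2 * a) := by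
  have h := (hasSum_pnat_iff (f := fun n : ℕ => 1 / (n : ℝ) ^ (2 * a))).mp
    (hasSum_pseries (by omega))
  rw [Nat.cast_zero, zero_pow (by omega), div_zero, add_zero] at h
  have h1 := h.unique (hasSum_zeta_nat ha)
  have h2 : pseries (2 * a) = (((-1) ^ (a + 1) * 2 ^ (2 * a - 1) * bernoulli (2 * a) /
      (2 * a).factorial : ℚ) : ℝ) * Real.pi ^ (2 * a) := by
    rw [h1]; push_cast; ring
  refine ⟨_, fun h0 => ?_, h2⟩
  rw [h0, Rat.cast_zero, zero_mul] at h2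
  exact (pseries_pos (by omega)).ne' h2

/-! ### Lattice sums and their recursion -/

/-- The terms `n ^ (N - 1 - 2 N (m - i)) k ^ (-2 i) / ((2 n) ^ (2 N) + (2 k) ^ 2)`. -/
noncomputable def latticeTerm (N m i : ℕ) (n k : ℕ+) : ℝ :=
  (n : ℝ) ^ (N - 1) * (n : ℝ) ^ (2 * N * i) /
    ((n : ℝ) ^ (2 * N * m) * (k : ℝ) ^ (2 * i) * (4 ^ N * (n : ℝ) ^ (2 * N) + 4 * (k : ℝ) ^ 2))

theorem latticeTerm_nonneg (N m i : ℕ) (n k : ℕ+) : 0 ≤ latticeTerm N m i n k := by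
  unfold latticeTerm; positivity

/-- The combination puts 4k² + 4^N n^(2N) in the numerator, which cancels the denominator and
separates the variables. For odd N both remaining exponents are even. -/
theorem four_mul_latticeTerm_add {N m i : ℕ} (hN : 0 < N) (hi : i < m) (n k : ℕ+) :
    4 * latticeTerm N m i n k + 4 ^ N * latticeTerm N m (i + 1) n k =
      1 / (n : ℝ) ^ (2 * N * (m - 1 - i) + N + 1) * (1 / (k : ℝ) ^ (2 * i + 2)) := by
  obtain ⟨d, rfl⟩ := Nat.exists_eq_add_of_lt hi
  obtain ⟨M, rfl⟩ := Nat.exists_eq_add_of_lt hN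
  have hn : 0 < (n : ℝ) := by exact_mod_cast n.pos
  have hk : 0 < (k : ℝ) := by exact_mod_cast k.pos
  unfold latticeTerm
  have e : i + d + 1 - 1 - i = d := by omega
  rw [e]
  simp only [zero_add, Nat.add_sub_cancel]
  generalize (n : ℝ) = x at *
  generalize (k : ℝ) = z at *
  have hD : (4 ^ (M + 1) * x ^ (2 * (M + 1)) + 4 * z ^ 2) ≠ 0 := by positivity
  have e1 : x ^ (2 * (M + 1) * (i + d + 1)) =
      x ^ (2 * (M + 1) * i) * x ^ (2 * (M + 1) * d) * x ^ (2 * (M + 1)) := by ring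
  have e2 : x ^ (2 * (M + 1) * (i + 1)) = x ^ (2 * (M + 1) * i) * x ^ (2 * (M + 1)) := by ring
  have e3 : x ^ (2 * (M + 1) * d + (M + 1) + 1) * x ^ M =
      x ^ (2 * (M + 1) * d) * x ^ (2 * (M + 1)) := by ring
  have e4 : z ^ (2 * (i + 1)) = z ^ (2 * i) * z ^ 2 := by ring
  have e5 : z ^ (2 * i + 2) = z ^ (2 * i) * z ^ 2 := by ring
  have e6 : 1 / x ^ (2 * (M + 1) * d + (M + 1) + 1) =
      x ^ M / (x ^ (2 * (M + 1) * d) * x ^ (2 * (M + 1))) := by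
    rw [← e3]; field_simp
  rw [e6, e1, e2, e4, e5]
  clear e1 e2 e3 e4 e5 e6
  have h1 : x ^ (2 * (M + 1) * i) ≠ 0 := by positivity
  have h2 : x ^ (2 * (M + 1)) ≠ 0 := by positivity
  have h3 : x ^ (2 * (M + 1) * d) ≠ 0 := by positivity
  have h4 : z ^ (2 * i) ≠ 0 := by positivity
  generalize x ^ (2 * (M + 1) * i) = u at *
  generalize x ^ (2 * (M + 1) * d) = v at *
  generalize x ^ (2 * (M + 1)) = w at *
  generalize z ^ (2 * i) = t at *
  generalize x ^ M = s at *
  generalize (4 : ℝ) ^ (M + 1) = c at *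
  obtain ⟨D, hDe⟩ : ∃ D, D = c * w + 4 * z ^ 2 := ⟨_, rfl⟩
  rw [← hDe] at hD ⊢
  field_simp
  rw [hDe]
  ring

theorem hasSum_pseries_mul_pseries {a b : ℕ} (ha : 1 < a) (hb : 1 < b) :
    HasSum (fun p : ℕ+ × ℕ+ => 1 / (p.1 : ℝ) ^ a * (1 / (p.2 : ℝ) ^ b))
      (pseries a * pseries b) :=
  (hasSum_pseries ha).mul (hasSum_pseries hb) <|
    (hasSum_pseries ha).summable.mul_of_nonneg (hasSum_pseries hb).summable
      (fun n => by positivity) (fun n => by positivity)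

theorem summable_latticeTerm {N m i : ℕ} (hN : 0 < N) (hm : 0 < m) (hi : i ≤ m) :
    Summable fun p : ℕ+ × ℕ+ => latticeTerm N m i p.1 p.2 := by
  have key : ∀ i < m, Summable (fun p : ℕ+ × ℕ+ =>
      4 * latticeTerm N m i p.1 p.2 + 4 ^ N * latticeTerm N m (i + 1) p.1 p.2) := fun i hi =>
    (hasSum_pseries_mul_pseries (a := 2 * N * (m - 1 - i) + N + 1) (b := 2 * i + 2)
      (by omega) (by omega)).summable.congr
      fun p => (four_mul_latticeTerm_add hN hi p.1 p.2).symm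
  rcases hi.lt_or_eq with h | rfl
  · refine Summable.of_nonneg_of_le (fun p => latticeTerm_nonneg _ _ _ _ _) (fun p => ?_) (key i h)
    have h1 := latticeTerm_nonneg N m i p.1 p.2
    have h2 := mul_nonneg (pow_nonneg zero_le_four N) (latticeTerm_nonneg N m (i + 1) p.1 p.2)
    linarith
  -- The last index has no successor relation, so it is bounded through the relation at m - 1.
  · obtain ⟨l, rfl⟩ := Nat.exists_eq_add_of_lt hm
    rw [zero_add] at *
    refine Summable.of_nonneg_of_le (fun p => latticeTerm_nonneg _ _ _ _ _) (fun p => ?_)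
      (key l (by omega))
    have h1 := latticeTerm_nonneg N (l + 1) l p.1 p.2
    have h2 := latticeTerm_nonneg N (l + 1) (l + 1) p.1 p.2
    have h3 : (1 : ℝ) ≤ 4 ^ N := one_le_pow₀ (by norm_num)
    nlinarith [mul_le_mul_of_nonneg_right h3 h2]

/-- The double sum of `latticeTerm`. -/
noncomputable def latticeSum (N m i : ℕ) : ℝ :=
  ∑' p : ℕ+ × ℕ+, latticeTerm N m i p.1 p.2

theorem hasSum_latticeSum {N m i : ℕ} (hN : 0 < N) (hm : 0 < m) (hi : i ≤ m) :
    HasSum (fun p : ℕ+ × ℕ+ => latticeTerm N m i p.1 p.2) (latticeSum N m i) :=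
  (summable_latticeTerm hN hm hi).hasSum

theorem latticeSum_nonneg (N m i : ℕ) : 0 ≤ latticeSum N m i :=
  tsum_nonneg fun _ => latticeTerm_nonneg _ _ _ _ _

theorem four_mul_latticeSum_add {N m i : ℕ} (hN : 0 < N) (hi : i < m) :
    4 * latticeSum N m i + 4 ^ N * latticeSum N m (i + 1) =
      pseries (2 * N * (m - 1 - i) + N + 1) * pseries (2 * i + 2) := by
  have hm : 0 < m := by omega
  refine HasSum.unique (((hasSum_latticeSum hN hm hi.le).mul_left 4).add
    ((hasSum_latticeSum hN hm hi).mul_left (4 ^ N))) ?_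
  simp_rw [four_mul_latticeTerm_add hN hi]
  exact hasSum_pseries_mul_pseries (by omega) (by omega)

/-- Iterates the recursion, evaluating each product of even zeta values by Euler's formula. -/
theorem exists_rat_latticeSum_zero {N m : ℕ} (hN : Odd N) :
    ∃ r : ℕ → ℚ, ∀ i ≤ m, latticeSum N m 0 =
      ∑ l ∈ Finset.range i, r l * Real.pi ^ (2 * N * (m - 1 - l) + N + 1 + (2 * l + 2)) +
        (-4 ^ (N - 1)) ^ i * latticeSum N m i := by
  have h : ∀ l : ℕ, ∃ q : ℚ, pseries (2 * N * (m - 1 - l) + N + 1) * pseries (2 * l + 2) =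
      q * Real.pi ^ (2 * N * (m - 1 - l) + N + 1 + (2 * l + 2)) := by
    intro l
    obtain ⟨h, hh⟩ := hN
    obtain ⟨q₁, -, h₁⟩ := exists_rat_pseries_even (a := N * (m - 1 - l) + h + 1) (by omega)
    obtain ⟨q₂, -, h₂⟩ := exists_rat_pseries_even (a := l + 1) (by omega)
    have e₁ : 2 * N * (m - 1 - l) + N + 1 = 2 * (N * (m - 1 - l) + h + 1) := by
      rw [mul_assoc]; omega
    have e₂ : 2 * l + 2 = 2 * (l + 1) := by ring
    refine ⟨q₁ * q₂, ?_⟩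
    rw [e₁, e₂, h₁, h₂, pow_add]
    push_cast
    ring
  choose q hq using h
  refine ⟨fun l => (-4 ^ (N - 1)) ^ l * q l / 4, fun i => ?_⟩
  induction i with
  | zero => simp
  | succ i ih =>
    intro hi
    rw [ih (by omega), Finset.sum_range_succ, add_assoc]
    congr 1
    have h1 := four_mul_latticeSum_add hN.pos (Nat.lt_of_succ_le hi)
    rw [hq i] at h1
    have h2 : (4 : ℝ) ^ N = 4 * 4 ^ (N - 1) := by
      rw [← pow_succ', Nat.sub_add_cancel hN.pos]
    rw [h2] at h1
    push_cast
    rw [pow_succ]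
    linear_combination ((-4 ^ (N - 1)) ^ i / 4 : ℝ) * h1

/-! ### The two orders of summation -/

/-- The value of the Lambert series in terms of the lattice sum. -/
theorem hasSum_lambertTerm {N m : ℕ} (hN : 0 < N) (hm : 0 < m) :
    HasSum (lambertTerm N m) (pseries (2 * N * m + N + 1) / (2 ^ N * Real.pi) -
      pseries (2 * N * m + 1) / 2 + 2 ^ (N + 1) / Real.pi * latticeSum N m 0) := by
  have hpi := Real.pi_pos
  have hNm : 0 < N * m := Nat.mul_pos hN hm
  have h1 : ∀ n : ℕ+, HasSum (fun k : ℕ+ => 2 ^ (N + 1) / Real.pi * latticeTerm N m 0 n k)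
      (lambertTerm N m n + 1 / 2 * (1 / (n : ℝ) ^ (2 * N * m + 1)) -
        1 / (2 ^ N * Real.pi) * (1 / (n : ℝ) ^ (2 * N * m + N + 1))) := by
    intro n
    have hn : 0 < (n : ℝ) := by exact_mod_cast n.pos
    set x : ℝ := (2 * (n : ℝ)) ^ N * Real.pi with hx
    have hx0 : 0 < x := by positivity
    have h2 := hasSum_expKernel (x := (x : ℂ)) (fun l => by
      norm_cast
      positivity)
    have h3 := (Complex.hasSum_re h2).mul_left (1 / (n : ℝ) ^ (2 * N * m + 1))
    convert! h3 using 1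
    · funext k
      have hk : 0 < (k : ℝ) := by exact_mod_cast k.pos
      have e : (2 * ((x : ℂ) / ((x : ℂ) ^ 2 + ((2 * Real.pi * (k : ℝ) : ℝ) : ℂ) ^ 2))).re =
          2 * (x / (x ^ 2 + (2 * Real.pi * (k : ℝ)) ^ 2)) := by norm_cast
      rw [e, latticeTerm, hx]
      obtain ⟨M, rfl⟩ := Nat.exists_eq_add_of_lt hN
      simp only [zero_add, Nat.add_sub_cancel, mul_zero, pow_zero, mul_one]
      have e4 : (4 : ℝ) ^ (M + 1) = (2 ^ (M + 1)) ^ 2 := by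
        rw [← pow_mul, mul_comm, pow_mul]; norm_num
      have e5 : (n : ℝ) ^ (2 * (M + 1)) = (n * n ^ M) ^ 2 := by ring
      have e6 : (2 * (n : ℝ)) ^ (M + 1) = 2 ^ (M + 1) * (n * n ^ M) := by ring
      rw [e4, e5, e6, pow_succ (n : ℝ) (2 * (M + 1) * m), pow_succ (2 : ℝ) (M + 1)]
      have p1 : 0 < (n : ℝ) ^ M := by positivity
      have p2 : 0 < (n : ℝ) ^ (2 * (M + 1) * m) := by positivity
      have p3 : (0 : ℝ) < 2 ^ (M + 1) := by positivity
      clear_value x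
      clear h2 h3 e hx e5 e6 e4
      generalize (n : ℝ) ^ M = u at *
      generalize (n : ℝ) ^ (2 * (M + 1) * m) = v at *
      generalize (2 : ℝ) ^ (M + 1) = w at *
      generalize (n : ℝ) = a at *
      generalize (k : ℝ) = b at *
      have hD : 0 < w ^ 2 * (a * u) ^ 2 + 4 * b ^ 2 := by positivity
      have e7 : (w * (a * u) * Real.pi) ^ 2 + (2 * Real.pi * b) ^ 2 =
        Real.pi ^ 2 * (w ^ 2 * (a * u) ^ 2 + 4 * b ^ 2) := by ring
      rw [e7]
      generalize w ^ 2 * (a * u) ^ 2 + 4 * b ^ 2 = D at *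
      field_simp
    · have e : (expKernel x - 1 / x).re = 1 / (Real.exp x - 1) + 1 / 2 - 1 / x := by
        have : expKernel x - 1 / x = ((1 / (Real.exp x - 1) + 1 / 2 - 1 / x : ℝ) : ℂ) := by
          rw [expKernel]; push_cast; ring
        rw [this, Complex.ofReal_re]
      have e2 : (-2 * (N : ℤ) * (m : ℤ) - 1) = -((2 * N * m + 1 : ℕ) : ℤ) := by push_cast; ring
      rw [e, lambertTerm, e2, zpow_neg, zpow_natCast, ← hx]
      have e3 : 1 / (2 ^ N * Real.pi) * (1 / (n : ℝ) ^ (2 * N * m + N + 1)) =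
          1 / (n : ℝ) ^ (2 * N * m + 1) * (1 / x) := by
        rw [hx, mul_pow, add_right_comm, pow_add (n : ℝ) _ N]
        field_simp
      rw [e3]
      ring
  have h2 := ((hasSum_latticeSum hN hm (Nat.zero_le m)).mul_left
    (2 ^ (N + 1) / Real.pi)).prod_fiberwise h1
  have h3 := (h2.sub ((hasSum_pseries (a := 2 * N * m + 1) (by
    rw [mul_assoc]; omega)).mul_left (1 / 2))).add
    ((hasSum_pseries (a := 2 * N * m + N + 1) (by omega)).mul_left (1 / (2 ^ N * Real.pi)))
  convert! h3 using 1
  · funext n; ring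
  · ring

/-- `k`-th term of the sum attached to a complex direction `ξ`. -/
noncomputable def kernelTerm (N m : ℕ) (ξ : ℂ) (k : ℕ+) : ℝ :=
  1 / (k : ℝ) ^ (2 * m + 1) *
    (expKernel (((2 * (k : ℝ)) ^ (1 / (N : ℝ)) * Real.pi : ℝ) * ξ)).re

/-- The sums over all `N`-th roots of unity, in terms of the lattice sum. -/
theorem hasSum_sum_kernelTerm {N h m : ℕ} (hN : N = 2 * h + 1) (hm : 0 < m) {η : ℂ}
    (hη : IsPrimitiveRoot η N) :
    HasSum (fun k => ∑ j ∈ Finset.range N, kernelTerm N m (η ^ j) k)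
      ((4 * N * (-1) ^ h * 2 ^ (N - 1) / Real.pi) * latticeSum N m m +
        if N = 1 then 1 / (2 * Real.pi) * pseries (2 * m + 2) else 0) := by
  have hpi := Real.pi_pos
  have hN0 : 0 < N := by omega
  have h1 : ∀ k : ℕ+, HasSum (fun n : ℕ+ =>
      (4 * N * (-1) ^ h * 2 ^ (N - 1) / Real.pi) * latticeTerm N m m n k)
      (∑ j ∈ Finset.range N, kernelTerm N m (η ^ j) k -
        if N = 1 then 1 / (2 * Real.pi) * (1 / (k : ℝ) ^ (2 * m + 2)) else 0) := by
    intro k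
    have hk : 0 < (k : ℝ) := by exact_mod_cast k.pos
    set y : ℝ := (2 * (k : ℝ)) ^ (1 / (N : ℝ)) * Real.pi with hy
    have hy0 : 0 < y := by positivity
    -- This is why the N-th root of 2k appears: y^(2N) + (2πn)^(2N) becomes π^(2N) times the lattice
    -- denominator.
    have hyN : y ^ N = 2 * k * Real.pi ^ N := by
      rw [hy, mul_pow, ← Real.rpow_natCast, ← Real.rpow_mul (by positivity),
        one_div_mul_cancel (by positivity), Real.rpow_one]
    have h3 := (hasSum_sum_expKernel hN hη hy0).mul_left (1 / (k : ℝ) ^ (2 * m + 1))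
    convert! h3 using 1
    · funext n
      have hn : 0 < (n : ℝ) := by exact_mod_cast n.pos
      have e1 : y ^ (2 * N) = 4 * k ^ 2 * (Real.pi ^ N) ^ 2 := by
        rw [mul_comm 2, pow_mul, hyN]; ring
      rw [latticeTerm, e1, hyN]
      obtain ⟨M, rfl⟩ := Nat.exists_eq_add_of_lt hN0
      simp only [zero_add, Nat.add_sub_cancel]
      have e4 : (4 : ℝ) ^ (M + 1) = (2 ^ M * 2) ^ 2 := by
        rw [← pow_succ, ← pow_mul, mul_comm, pow_mul]; norm_num
      have e5 : (n : ℝ) ^ (2 * (M + 1)) = (n * n ^ M) ^ 2 := by ring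
      have e6 : (2 * Real.pi * (n : ℝ)) ^ (2 * (M + 1)) =
        (2 ^ M * 2 * (Real.pi ^ M * Real.pi) * (n * n ^ M)) ^ 2 := by ring
      have e8 : (2 * Real.pi * (n : ℝ)) ^ M = 2 ^ M * Real.pi ^ M * n ^ M := by ring
      rw [e4, e5, e6, e8, pow_succ (k : ℝ) (2 * m), pow_succ Real.pi]
      have p1 : 0 < (n : ℝ) ^ M := by positivity
      have p2 : 0 < (n : ℝ) ^ (2 * (M + 1) * m) := by positivity
      have p3 : (0 : ℝ) < 2 ^ M := by positivity
      have p4 : 0 < (k : ℝ) ^ (2 * m) := by positivity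
      have p5 : 0 < Real.pi ^ M := by positivity
      clear_value y
      clear h3 hy hyN hy0 e1 e5 e6 e4 e8
      generalize (n : ℝ) ^ M = u at *
      generalize (n : ℝ) ^ (2 * (M + 1) * m) = v at *
      generalize (2 : ℝ) ^ M = w at *
      generalize (k : ℝ) ^ (2 * m) = t at *
      generalize Real.pi ^ M = q at *
      generalize (n : ℝ) = a at *
      generalize (k : ℝ) = b at *
      have hD : 0 < (w * 2) ^ 2 * (a * u) ^ 2 + 4 * b ^ 2 := by positivity
      have e7 : 4 * b ^ 2 * (q * Real.pi) ^ 2 + (w * 2 * (q * Real.pi) * (a * u)) ^ 2 =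
        (q * Real.pi) ^ 2 * ((w * 2) ^ 2 * (a * u) ^ 2 + 4 * b ^ 2) := by ring
      rw [e7]
      generalize (w * 2) ^ 2 * (a * u) ^ 2 + 4 * b ^ 2 = D at *
      field_simp
      ring
    · rw [mul_sub, Finset.mul_sum]
      congr 1
      split_ifs with hN1
      · subst hN1
        have : y = 2 * k * Real.pi := by simpa using hyN
        rw [this, pow_succ (k : ℝ) (2 * m + 1)]
        field_simp
      · rw [mul_zero]
  have h2 : HasSum (fun p : ℕ+ × ℕ+ =>
      (4 * N * (-1) ^ h * 2 ^ (N - 1) / Real.pi) * latticeTerm N m m p.2 p.1)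
      ((4 * N * (-1) ^ h * 2 ^ (N - 1) / Real.pi) * latticeSum N m m) :=
    ((Equiv.prodComm ℕ+ ℕ+).hasSum_iff.mpr (hasSum_latticeSum hN0 hm le_rfl)).mul_left _
  have h3 := h2.prod_fiberwise h1
  have h4 : HasSum (fun k : ℕ+ =>
      if N = 1 then 1 / (2 * Real.pi) * (1 / (k : ℝ) ^ (2 * m + 2)) else 0)
      (if N = 1 then 1 / (2 * Real.pi) * pseries (2 * m + 2) else 0) := by
    split_ifs
    · exact (hasSum_pseries (by omega)).mul_left _
    · exact hasSum_zero
  convert! h3.add h4 using 1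
  funext k
  ring

/-! ### From roots of unity to the series B_j -/

/-- A primitive `N`-th root of unity, for odd `N`, with argument `π + π / N`. -/
noncomputable def negRoot (N : ℕ) : ℂ := -Complex.exp (Complex.I * Real.pi / N)

theorem isPrimitiveRoot_negRoot {N : ℕ} (hN : Odd N) : IsPrimitiveRoot (negRoot N) N := by
  obtain ⟨h, hh⟩ := hN
  have hN0 : N ≠ 0 := by omega
  have h1 := Complex.isPrimitiveRoot_exp_of_coprime (h + 1) N hN0 (by
    rw [hh, show 2 * h + 1 = (h + 1) + h by ring]
    simp)
  convert! h1 using 1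
  have hN' : (N : ℂ) ≠ 0 := Nat.cast_ne_zero.mpr hN0
  have e : 2 * (Real.pi : ℂ) * Complex.I * (((h + 1 : ℕ) : ℂ) / N) =
      Complex.I * Real.pi / N + Real.pi * Complex.I := by
    field_simp
    rw [hh]
    push_cast
    ring
  rw [negRoot, e, Complex.exp_add, Complex.exp_pi_mul_I]
  ring

theorem lambertRootTerm_eq (N m j : ℕ) (k : ℕ+) :
    lambertRootTerm N m j k =
      kernelTerm N m (Complex.exp (Complex.I * Real.pi * j / N)) k -
        1 / 2 * (1 / (k : ℝ) ^ (2 * m + 1)) := by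
  rw [lambertRootTerm, kernelTerm, expKernel, Complex.add_re]
  push_cast
  norm_num
  ring

/-- As j < N/2, the exponent has real part at least π cos(πj/N) > 0, which bounds the kernel
uniformly in the summation index. -/
theorem summable_lambertRootTerm {N m j : ℕ} (hm : 0 < m) (hN : 0 < N)
    (hj : j ≤ (N - 1) / 2) : Summable (lambertRootTerm N m j) := by
  have hpi := Real.pi_pos
  set c := Real.cos (Real.pi * j / N) with hc
  have hN' : (0 : ℝ) < N := by exact_mod_cast hN
  have hj' : (j : ℝ) < N / 2 := by
    have : 2 * j < N := by omega
    have : (2 : ℝ) * j < N := by exact_mod_cast this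
    linarith
  have hc0 : 0 < c := by
    apply Real.cos_pos_of_mem_Ioo
    constructor
    · have : 0 ≤ Real.pi * j / N := by positivity
      linarith
    · rw [div_lt_iff₀ hN']
      nlinarith
  have hb : 0 < Real.exp (Real.pi * c) - 1 := by
    have := Real.add_one_lt_exp (mul_pos hpi hc0).ne'
    nlinarith [mul_pos hpi hc0]
  refine Summable.of_norm_bounded
    ((hasSum_pseries (a := 2 * m + 1) (by omega)).summable.mul_right
      (1 / (Real.exp (Real.pi * c) - 1))) fun k => ?_
  have hk : (1 : ℝ) ≤ k := Nat.one_le_cast.mpr k.pos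
  rw [lambertRootTerm, norm_mul, Real.norm_of_nonneg (by positivity)]
  gcongr
  refine (Complex.abs_re_le_norm _).trans ?_
  rw [norm_div, norm_one]
  refine one_div_le_one_div_of_le hb ?_
  refine le_trans ?_ (norm_sub_norm_le _ _)
  rw [norm_one, Complex.norm_exp]
  gcongr
  have e : Complex.I * (Real.pi : ℂ) * (j : ℂ) / (N : ℂ) =
      ((Real.pi * j / N : ℝ) : ℂ) * Complex.I := by push_cast; ring
  rw [e, ← Complex.ofReal_mul, Complex.re_ofReal_mul, Complex.exp_ofReal_mul_I_re, ← hc]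
  gcongr
  have h1 : (1 : ℝ) ≤ (2 * (k : ℝ)) ^ (1 / (N : ℝ)) :=
    Real.one_le_rpow (by linarith) (by positivity)
  nlinarith

theorem exp_mul_root_ne_one {N : ℕ} (hN : Odd N) {ξ : ℂ} (hξ : ξ ^ N = 1) {y : ℝ}
    (hy : 0 < y) : Complex.exp (y * ξ) ≠ 1 := by
  intro h
  obtain ⟨l, hl⟩ := Complex.exp_eq_one_iff.mp h
  apply mul_root_sq_add_sq_ne_zero hN hξ hy (2 * Real.pi * l) 1
  rw [pow_one, hl]
  push_cast
  linear_combination (2 * (Real.pi : ℂ) * l) ^ 2 * Complex.I_sq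

open ComplexConjugate in
theorem kernelTerm_conj (N m : ℕ) (ξ : ℂ) (k : ℕ+) :
    kernelTerm N m (conj ξ) k = kernelTerm N m ξ k := by
  have h : ∀ y : ℝ, (y : ℂ) * conj ξ = conj (y * ξ) := fun y => by
    rw [map_mul, Complex.conj_ofReal]
  rw [kernelTerm, kernelTerm, h, expKernel_conj, Complex.conj_re]

/-- `negRoot N ^ j` is (-1)^j e^(iπj/N), and the kernel is odd. -/
theorem kernelTerm_negRoot_pow {N : ℕ} (hN : Odd N) (m j : ℕ) (k : ℕ+) :
    kernelTerm N m (negRoot N ^ j) k =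
      (-1) ^ j * kernelTerm N m (Complex.exp (Complex.I * Real.pi * j / N)) k := by
  have hk : 0 < (k : ℝ) := by exact_mod_cast k.pos
  have hy : 0 < (2 * (k : ℝ)) ^ (1 / (N : ℝ)) * Real.pi := by
    have := Real.pi_pos
    positivity
  have e : negRoot N ^ j = (-1) ^ j * Complex.exp (Complex.I * Real.pi * j / N) := by
    rw [negRoot, neg_pow, ← Complex.exp_nat_mul]
    congr 2
    ring
  have e' : Complex.exp (Complex.I * Real.pi * j / N) = (-1) ^ j * negRoot N ^ j := by
    rw [e, ← mul_assoc, ← mul_pow]; simp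
  rw [e']
  have hne : Complex.exp (((2 * (k : ℝ)) ^ (1 / (N : ℝ)) * Real.pi : ℝ) * negRoot N ^ j) ≠ 1 :=
    exp_mul_root_ne_one hN (by
      rw [← pow_mul, mul_comm, pow_mul, (isPrimitiveRoot_negRoot hN).pow_eq_one, one_pow]) hy
  unfold kernelTerm
  rcases Nat.even_or_odd j with hj | hj
  · simp [hj.neg_one_pow]
  · rw [hj.neg_one_pow, hj.neg_one_pow, neg_one_mul (negRoot N ^ j), mul_neg, expKernel_neg hne, Complex.neg_re]
    ring

/-- Each `kernelTerm` series over a root of unity is, up to sign, one of the Lambert series. -/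
theorem exists_hasSum_kernelTerm {N m j : ℕ} (hN : Odd N) (hm : 0 < m) (hj : j < N) :
    ∃ i ≤ (N - 1) / 2, HasSum (kernelTerm N m (negRoot N ^ j))
      ((-1) ^ i * ((∑' k, lambertRootTerm N m i k) + 1 / 2 * pseries (2 * m + 1))) := by
  have key : ∀ i ≤ (N - 1) / 2, HasSum (kernelTerm N m (negRoot N ^ i))
      ((-1) ^ i * ((∑' k, lambertRootTerm N m i k) + 1 / 2 * pseries (2 * m + 1))) := by
    intro i hi
    have h1 := ((summable_lambertRootTerm hm hN.pos hi).hasSum.add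
      ((hasSum_pseries (a := 2 * m + 1) (by omega)).mul_left (1 / 2))).mul_left ((-1) ^ i)
    convert! h1 using 1
    funext k
    rw [kernelTerm_negRoot_pow hN, lambertRootTerm_eq]
    ring
  by_cases h : j ≤ (N - 1) / 2
  · exact ⟨j, h, key j h⟩
  -- Conjugation replaces the exponent j by N - j and preserves the real part.
  · obtain ⟨d, hd⟩ := hN
    refine ⟨N - j, by omega, ?_⟩
    convert! key (N - j) (by omega) using 1
    funext k
    rw [← kernelTerm_conj]
    have hr := isPrimitiveRoot_negRoot ⟨d, hd⟩
    have hnorm : ‖negRoot N‖ = 1 := hr.norm'_eq_one (by omega)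
    congr 1
    rw [map_pow, ← Complex.inv_eq_conj hnorm, pow_sub₀ _ (hr.ne_zero (by omega)) hj.le,
      hr.pow_eq_one, one_mul, inv_pow]

/-! ### The relation with π and the conclusion -/

theorem isAlgebraic_of_ofReal {x : ℝ} (hx : IsAlgebraic ℚ (x : ℂ)) : IsAlgebraic ℚ x :=
  (isAlgebraic_algebraMap_iff (algebraMap ℝ ℂ).injective).mp hx

open Polynomial in
theorem transcendental_aeval_pi {P : ℚ[X]} (hP : P.natDegree ≠ 0) :
    Transcendental ℚ (aeval Real.pi P) :=
  transcendental_aeval_iff.mpr ⟨transcendental_pi, P.transcendental hP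
    (mem_nonZeroDivisors_of_ne_zero (leadingCoeff_ne_zero.mpr fun h => hP (by simp [h])))⟩

/-- The relation between the zeta values, the Lambert series and `π`. -/
theorem exists_relation {N m h : ℕ} (hm : 0 < m) (hN : N = 2 * h + 1) {S : ℝ}
    (hS : HasSum (fun k => ∑ j ∈ Finset.range N, kernelTerm N m (negRoot N ^ j) k) S) :
    ∃ (q q' : ℚ) (r : ℕ → ℚ), q ≠ 0 ∧
      (∑' n, lambertTerm N m n) + pseries (2 * N * m + 1) / 2 -
          (-4 ^ (N - 1)) ^ m * (-1) ^ h / N * S =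
        q * Real.pi ^ (2 * N * m + N) +
          ∑ l ∈ Finset.range m, r l * Real.pi ^ (2 * N * (m - 1 - l) + N + (2 * l + 2)) +
          if N = 1 then q' * Real.pi ^ (2 * m + 1) else 0 := by
  have hpi := Real.pi_pos
  have ho : Odd N := ⟨h, hN⟩
  have hN0 : (N : ℝ) ≠ 0 := by exact_mod_cast ho.pos.ne'
  have h1 := (hasSum_lambertTerm ho.pos hm).tsum_eq
  have h2 := hS.unique (hasSum_sum_kernelTerm hN hm (isPrimitiveRoot_negRoot ho))
  obtain ⟨r, hr⟩ := exists_rat_latticeSum_zero (m := m) ho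
  have h3 := hr m le_rfl
  obtain ⟨q₁, hq₁, e₁⟩ := exists_rat_pseries_even (a := N * m + h + 1) (by omega)
  obtain ⟨q₂, -, e₂⟩ := exists_rat_pseries_even (a := m + 1) (by omega)
  rw [show 2 * (N * m + h + 1) = 2 * N * m + N + 1 by rw [mul_assoc]; omega] at e₁
  rw [show 2 * (m + 1) = 2 * m + 2 by ring] at e₂
  refine ⟨q₁ / 2 ^ N, -((-4 ^ (N - 1)) ^ m * (-1) ^ h * q₂ / (2 * N)),
    fun l => 2 ^ (N + 1) * r l, by positivity, ?_⟩
  have e₃ : ∑ l ∈ Finset.range m, ((2 ^ (N + 1) * r l : ℚ) : ℝ) *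
      Real.pi ^ (2 * N * (m - 1 - l) + N + (2 * l + 2)) = 2 ^ (N + 1) / Real.pi *
      ∑ l ∈ Finset.range m, r l * Real.pi ^ (2 * N * (m - 1 - l) + N + 1 + (2 * l + 2)) := by
    rw [Finset.mul_sum]
    refine Finset.sum_congr rfl fun l _ => ?_
    rw [add_right_comm _ 1, pow_succ]
    push_cast
    field_simp
    ring
  have hsq : ((-1 : ℝ) ^ h) * (-1) ^ h = 1 := by rw [← mul_pow]; simp
  have h2N : (2 : ℝ) ^ (N + 1) = 4 * 2 ^ (N - 1) := by
    obtain ⟨M, rfl⟩ : ∃ M, N = M + 1 := ⟨2 * h, hN⟩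
    rw [Nat.add_sub_cancel]; ring
  rw [e₃, h1, h3, h2, e₁, e₂, h2N, pow_succ Real.pi (2 * N * m + N),
    pow_succ Real.pi (2 * m + 1)]
  generalize ∑ l ∈ Finset.range m, (r l : ℝ) *
    Real.pi ^ (2 * N * (m - 1 - l) + N + 1 + (2 * l + 2)) = R
  push_cast
  split_ifs with hN1
  · field_simp
    linear_combination (-8 * (-4 ^ (N - 1)) ^ m * N * 2 ^ (N - 1) * 2 ^ N * latticeSum N m m) * hsq
  · field_simp
    linear_combination (-8 * (-4 ^ (N - 1)) ^ m * N * 2 ^ (N - 1) * 2 ^ N * latticeSum N m m) * hsq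

open Polynomial in
theorem transcendental_of_one_lt {N m : ℕ} (hN : 1 < N) {q : ℚ} (hq : q ≠ 0) (r : ℕ → ℚ) :
    Transcendental ℚ (q * Real.pi ^ (2 * N * m + N) +
      ∑ l ∈ Finset.range m, r l * Real.pi ^ (2 * N * (m - 1 - l) + N + (2 * l + 2))) := by
  let R : ℚ[X] := ∑ l ∈ Finset.range m, C (r l) * X ^ (2 * N * (m - 1 - l) + N + (2 * l + 2))
  have hR : R.natDegree < 2 * N * m + N := by
    refine lt_of_le_of_lt (natDegree_sum_le_of_forall_le (n := 2 * N * m + N - 1) _ _ ?_)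
      (by omega)
    intro l hl
    refine (natDegree_C_mul_X_pow_le _ _).trans ?_
    -- The exponent equals 2Nm + N - (2N - 2)(l + 1), below the top one because N > 1.
    obtain ⟨d, rfl⟩ := Nat.exists_eq_add_of_lt (Finset.mem_range.mp hl)
    rw [show l + d + 1 - 1 - l = d by omega]
    have : 2 * l ≤ N * l := Nat.mul_le_mul_right l hN
    have e : 2 * N * (l + d + 1) = 2 * N * d + 2 * (N * l) + 2 * N := by ring
    omega
  have hP : (C q * X ^ (2 * N * m + N) + R).natDegree ≠ 0 := by
    rw [natDegree_add_eq_left_of_natDegree_lt] <;> rw [natDegree_C_mul_X_pow _ _ hq]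
    · omega
    · exact hR
  convert transcendental_aeval_pi hP using 1
  simp [R]

/-- A nonzero rational multiple of a positive power of `π` is transcendental. -/
theorem transcendental_of_eq_mul_pow {V : ℝ} (hV : V ≠ 0) {q : ℚ} {a : ℕ} (ha : a ≠ 0)
    (h : V = q * Real.pi ^ a) : Transcendental ℚ V := by
  have hq : q ≠ 0 := by
    rintro rfl
    simp [h] at hV
  have hP : (Polynomial.C q * Polynomial.X ^ a).natDegree ≠ 0 := by
    rwa [Polynomial.natDegree_C_mul_X_pow _ _ hq]
  convert transcendental_aeval_pi hP using 1
  simp [h]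

theorem lambertTerm_nonneg (N m : ℕ) (n : ℕ+) : 0 ≤ lambertTerm N m n := by
  unfold lambertTerm
  have h : 1 ≤ Real.exp ((2 * (n : ℝ)) ^ N * Real.pi) :=
    Real.one_le_exp (by have := Real.pi_pos; positivity)
  exact div_nonneg (by positivity) (sub_nonneg.mpr h)

theorem mainTheorem5 (N m : ℕ) (hm : 0 < m) (hN : Odd N)
    (h : Odd m ∨ (Even m ∧ 1 < N)) :
    Summable (lambertTerm N m) ∧
    (∀ j : ℕ, j ≤ (N - 1) / 2 → Summable (lambertRootTerm N m j)) ∧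
    (Transcendental ℚ (riemannZeta (2 * (m : ℂ) + 1)) ∨
      Transcendental ℚ (riemannZeta (2 * (N : ℂ) * (m : ℂ) + 1)) ∨
      Transcendental ℚ (∑' n : ℕ+, lambertTerm N m n) ∨
      ∃ j : ℕ, j ≤ (N - 1) / 2 ∧
        Transcendental ℚ (∑' n : ℕ+, lambertRootTerm N m j n)) := by
  refine ⟨(hasSum_lambertTerm hN.pos hm).summable,
    fun j hj => summable_lambertRootTerm hm hN.pos hj, ?_⟩
  by_contra! hcon
  simp only [Transcendental, not_not] at hcon
  obtain ⟨hz₁, hz₂, hA, hB⟩ := hcon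
  have hNm : 0 < N * m := Nat.mul_pos hN.pos hm
  have hm1 : 1 < 2 * m + 1 := by omega
  have hNm1 : 1 < 2 * N * m + 1 := by rw [mul_assoc]; omega
  have hz₁' : IsAlgebraic ℚ (pseries (2 * m + 1)) := by
    apply isAlgebraic_of_ofReal
    rw [← riemannZeta_eq_pseries hm1]
    exact_mod_cast hz₁
  have hz₂' : IsAlgebraic ℚ (pseries (2 * N * m + 1)) := by
    apply isAlgebraic_of_ofReal
    rw [← riemannZeta_eq_pseries hNm1]
    exact_mod_cast hz₂
  have hq : ∀ q : ℚ, IsAlgebraic ℚ (q : ℝ) := isAlgebraic_ratCast ℚ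
  have hS : ∀ j : ℕ, ∃ s : ℝ, IsAlgebraic ℚ s ∧
      (j < N → HasSum (kernelTerm N m (negRoot N ^ j)) s) := by
    intro j
    by_cases hj : j < N
    · obtain ⟨i, hi, hs⟩ := exists_hasSum_kernelTerm hN hm hj
      refine ⟨_, ?_, fun _ => hs⟩
      have := (hq ((-1) ^ i)).mul ((hB i hi).add ((hq (1 / 2)).mul hz₁'))
      push_cast at this
      exact this
    · exact ⟨0, isAlgebraic_zero, fun h => absurd h hj⟩
  choose s hs₁ hs₂ using hS
  obtain ⟨d, hd⟩ := hN
  have hsum : HasSum (fun k => ∑ j ∈ Finset.range N, kernelTerm N m (negRoot N ^ j) k)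
      (∑ j ∈ Finset.range N, s j) := hasSum_sum fun j hj => hs₂ j (Finset.mem_range.mp hj)
  obtain ⟨q, q', r, hq0, hrel⟩ := exists_relation hm hd hsum
  have halg : IsAlgebraic ℚ ((∑' n, lambertTerm N m n) + pseries (2 * N * m + 1) / 2 -
      (-4 ^ (N - 1)) ^ m * (-1) ^ d / N * ∑ j ∈ Finset.range N, s j) := by
    have h1 := (hA.add ((hq (1 / 2)).mul hz₂')).sub
      ((hq ((-4 ^ (N - 1)) ^ m * (-1) ^ d / N)).mul
        (Finset.sum_induction s (IsAlgebraic ℚ) (s := Finset.range N) (fun _ _ => IsAlgebraic.add)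
          isAlgebraic_zero fun j _ => hs₁ j))
    push_cast at h1
    convert! h1 using 1
    ring
  by_cases hN1 : N = 1
  · have hmo : Odd m := by
      rcases h with h | h
      · exact h
      · omega
    -- For N = 1 and m odd the factor (-4^(N-1))^m is -1, so the combination is A + ζ(2m+1)/2 + S,
    -- with S this sum, and positivity rules out cancellation.
    have hS0 : 0 ≤ ∑ j ∈ Finset.range N, s j := by
      rw [hsum.unique (hasSum_sum_kernelTerm hd hm (isPrimitiveRoot_negRoot ⟨d, hd⟩))]
      have h1 := latticeSum_nonneg N m m
      have h2 := (pseries_pos (a := 2 * m + 2) (by omega)).le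
      have h3 := Real.pi_pos
      have hd0 : d = 0 := by omega
      subst hd0
      rw [if_pos hN1]
      positivity
    have hA0 : 0 ≤ ∑' n, lambertTerm N m n := tsum_nonneg (lambertTerm_nonneg N m)
    have hz0 := pseries_pos hNm1
    have hd0 : d = 0 := by omega
    subst hd0
    subst hN1
    simp only [Nat.sub_self, pow_zero, hmo.neg_one_pow, if_true, mul_one, Nat.cast_one] at hrel halg
    refine transcendental_of_eq_mul_pow (V := _) (q := q + (∑ l ∈ Finset.range m, r l) + q')
      (a := 2 * m + 1) ?_ (by omega) ?_ halg
    · apply ne_of_gt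
      linarith
    · rw [hrel]
      push_cast
      rw [add_mul, add_mul, Finset.sum_mul]
      congr 2
      refine Finset.sum_congr rfl fun l hl => ?_
      congr 2
      have := Finset.mem_range.mp hl
      omega
  · rw [if_neg hN1, add_zero] at hrel
    rw [hrel] at halg
    exact transcendental_of_one_lt (by omega) hq0 r halg
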